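/- Let $\Sigma$ be the trivalent tree in the plane dual to the Farey triangulation, $\Omega$ the set of its complementary regions (so $\Omega$ is identified with $\mathbb{Q}\cup\{\infty\}$, two regions sharing an edge iff they are Farey neighbours). Write $e\leftrightarrow(X,Y;Z,W)$ if $e=X\cap Y$ is an edge whose endpoints lie on the regions $Z$ and $W$. Fix a colouring of the regions by $\{1,2,3\}$ in which regions sharing an edge have different colours; then the three regions at a vertex have the three colours, and $Z,W$ have equal colour whenever $e\leftrightarrow(X,Y;Z,W)$. Let $\mu=(p_1,p_2,p_3,s)=(p,q,r,s)\in\mathbb{C}^4$. A *$\mu$-Markoff map* is a function $\phi:\Omega\to\mathbb{C}$ such that * $x^2+y^2+z^2+xyz=px+qy+rz+s$ whenever $X,Y,Z$ are the regions of colours $1,2,3$ at a vertex and $x=\phi(X)$, $y=\phi(Y)$, $z=\phi(Z)$; * $\phi(Z)+\phi(W)=p_i-\phi(X)\phi(Y)$ whenever $e\leftrightarrow(X,Y;Z,W)$ and $Z,W$ have colour $i$. Let $\alpha=\frac12\max\{|p|,|q|,|r|\}$. A vertex where $X,Y,Z$ meet is a *sink* of $\phi$ if crossing any of its three edges does not decrease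 the modulus, i.e. $|\phi(Z)|\le|\phi(W)|$ when $X\cap Y\leftrightarrow(X,Y;Z,W)$, and likewise for the two other edges. Let $m=m(\mu)>2$ be any constant such that $\min\{|\phi(X)|,|\phi(Y)|,|\phi(Z)|\}\le m$ at every sink of every $\mu$-Markoff map $\phi$ (such constants exist). Let $\mathcal{S}_\mu$ be the finite set of all $x\in\mathbb{C}$ that satisfy, for some $\{i,j,k\}=\{1,2,3\}$, $$x^4-p_ix^3-(4+s)x^2-(p_jp_k-4p_i)x+p_j^2+p_k^2+4s=0 ;$$ equivalently, writing $p=ab+cd$, $q=ad+bc$, $r=ac+bd$, $s=4-a^2-b^2-c^2-d^2-abcd$, the set of the roots of the six polynomials $x^2-uvx+u^2+v^2-4$, where $u,v$ are two of the four entries of $(a,b,c,d)$. Put $$M=\max\left\{\left|\frac{2p_i-xp_j}{4-x^2}\right| : x\in\mathcal{S}_\mu\setminus\{\pm2\},\ i\ne j\right\}$$ ($M=0$ if this set is empty) and $L=L(\mu)=\max\{2+\alpha,\,m,\,M+1\}$. The $\mu$-Markoff map $\phi$ *satisfies the BQ-conditions* if (BQ1) $\phi(X)\notin[-2,2]$ for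 all $X\in\Omega$, and (BQ2) $|\phi(X)|\le L$ for only finitely many $X\in\Omega$. **Corollary.** If $\phi$ is a $\mu$-Markoff map satisfying the BQ-conditions, then for every real $t>0$ the series $\sum_{X\in\Omega}|\phi(X)|^{-t}$ converges (absolutely). -/

import Mathlib

namespace MarkoffTree

/-! ## The trivalent planar tree and its complementary regions

The trivalent plane tree is realised as the dual of the Farey triangulation of the hyperbolic
plane: complementary regions correspond to ideal vertices, that is, to points of `ℚ ∪ {∞}`,
edges of the tree to edges of the triangulation, vertices of the tree to its triangles. -/

/-- The complementary regions of the tree: `ℚ ∪ {∞}`. -/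
abbrev Region : Type := OnePoint ℚ

/-- Numerator of a region, with `∞ = 1/0`. -/
def num (X : Region) : ℤ := OnePoint.elim X 1 (fun q : ℚ => q.num)

/-- Denominator of a region, with `∞ = 1/0`. -/
def den (X : Region) : ℤ := OnePoint.elim X 0 (fun q : ℚ => (q.den : ℤ))

/-- The regions `X` and `Y` share an edge of the tree (Farey neighbours). -/
def IsEdge (X Y : Region) : Prop := |num X * den Y - num Y * den X| = 1

/-- The regions `X`, `Y`, `Z` are the three regions meeting at a vertex (Farey triangle). -/
def IsVertex (X Y Z : Region) : Prop := IsEdge X Y ∧ IsEdge Y Z ∧ IsEdge X Z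

/-- `e ↔ (X, Y; Z, W)`: the edge `e = X ∩ Y` has its two endpoints on `Z` and on `W`. -/
def EdgeEnds (X Y Z W : Region) : Prop := IsVertex X Y Z ∧ IsVertex X Y W ∧ Z ≠ W

/-- A tri-colouring of the regions: regions sharing an edge have different colours. An edge
`e ↔ (X, Y; Z, W)` carries the colour different from those of `X` and `Y`, which is the colour
of both `Z` and `W`. -/
def IsColoring (C : Region → Fin 3) : Prop := ∀ X Y : Region, IsEdge X Y → C X ≠ C Y

/-- A tri-colouring exists: colour a fraction by the parities of numerator and denominator. -/
theorem exists_isColoring : ∃ C : Region → Fin 3, IsColoring C := by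
  classical
  refine ⟨fun X => if Even (den X) then 0 else if Even (num X) then 1 else 2, ?_⟩
  intro X Y h hc
  have key : ¬ Even (num X * den Y - num Y * den X) := by
    intro he
    have : Even (1 : ℤ) := by
      have h' : |num X * den Y - num Y * den X| = 1 := h
      rw [← h']
      exact even_abs.2 he
    exact absurd this (by decide)
  apply key
  rw [Int.even_sub, Int.even_mul, Int.even_mul]
  by_cases h1 : Even (den X) <;> by_cases h2 : Even (den Y) <;> by_cases h3 : Even (num X) <;>
    by_cases h4 : Even (num Y) <;>
    simp only [h1, h2, h3, h4, if_true, if_false] at hc ⊢ <;> tauto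

/-! ## Markoff triples and Markoff maps

The parameter `μ = (p, q, r, s)` is given by `p : Fin 3 → ℂ`, the vector `(p, q, r)` indexed by
the three colours, and `s : ℂ`. -/

/-- `(x, y, z)` is a `μ`-Markoff triple. -/
def IsMarkoffTriple (p : Fin 3 → ℂ) (s x y z : ℂ) : Prop :=
  x ^ 2 + y ^ 2 + z ^ 2 + x * y * z = p 0 * x + p 1 * y + p 2 * z + s

/-- `φ` is a `μ`-Markoff map, with respect to the tri-colouring `C`. -/
structure IsMarkoffMap (C : Region → Fin 3) (p : Fin 3 → ℂ) (s : ℂ) (φ : Region → ℂ) : Prop where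
  vertex : ∀ X Y Z : Region, IsVertex X Y Z → C X = 0 → C Y = 1 → C Z = 2 →
    IsMarkoffTriple p s (φ X) (φ Y) (φ Z)
  edge : ∀ X Y Z W : Region, EdgeEnds X Y Z W → φ Z + φ W = p (C Z) - φ X * φ Y

/-! ## The constant `L(μ)` -/

/-- `α(μ) = max {|p|, |q|, |r|} / 2`. -/
noncomputable def alpha (p : Fin 3 → ℂ) : ℝ := max ‖p 0‖ (max ‖p 1‖ ‖p 2‖) / 2

/-- The vertex where `X`, `Y`, `Z` meet is a sink of `φ`: the arrows on its three edges all point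
towards it. The arrow of an edge `(X, Y; Z, W)` points from the end with the larger to the end
with the smaller value of `|φ|` (arbitrarily if they are equal). -/
def IsSink (φ : Region → ℂ) (X Y Z : Region) : Prop :=
  IsVertex X Y Z ∧
  (∀ W, EdgeEnds X Y Z W → ‖φ Z‖ ≤ ‖φ W‖) ∧
  (∀ W, EdgeEnds Y Z X W → ‖φ X‖ ≤ ‖φ W‖) ∧
  (∀ W, EdgeEnds X Z Y W → ‖φ Y‖ ≤ ‖φ W‖)

/-- `m` is an admissible constant `m(μ)`: at each sink of each `μ`-Markoff map, one of the three
regions has value at most `m` in modulus. -/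
def IsSinkConstant (C : Region → Fin 3) (p : Fin 3 → ℂ) (s : ℂ) (m : ℝ) : Prop :=
  ∀ φ : Region → ℂ, IsMarkoffMap C p s φ → ∀ X Y Z : Region, IsSink φ X Y Z →
    min ‖φ X‖ (min ‖φ Y‖ ‖φ Z‖) ≤ m

/-- The quartic `-4 Δ`, where `Δ` is the determinant (of the symmetric `3 × 3` matrix) of
the conic `y² + z² + x y z - q y - r z + x² - p x - s` in `(y, z)`. -/
def conicPoly (p q r s x : ℂ) : ℂ :=
  x ^ 4 - p * x ^ 3 - (4 + s) * x ^ 2 - (q * r - 4 * p) * x + (q ^ 2 + r ^ 2 + 4 * s)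

/-- The finite set `S(μ)` of the values `x` of a region for which the conic formed by the values of
consecutive neighbours is degenerate, for the three possible colours of the region. -/
def exceptionalSet (p : Fin 3 → ℂ) (s : ℂ) : Set ℂ :=
  {x | conicPoly (p 0) (p 1) (p 2) s x = 0 ∨ conicPoly (p 1) (p 0) (p 2) s x = 0 ∨
    conicPoly (p 2) (p 0) (p 1) s x = 0}

/-- `κ_{u,v}(x) = x² - u v x + u² + v² - 4`. -/
def kappa (u v x : ℂ) : ℂ := x ^ 2 - u * v * x + u ^ 2 + v ^ 2 - 4

/-- The moduli of the coordinates of the centres of the degenerate conics. -/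
def centerNorms (p : Fin 3 → ℂ) (s : ℂ) : Set ℝ :=
  {c | ∃ x ∈ exceptionalSet p s, x ≠ 2 ∧ x ≠ -2 ∧ ∃ i j : Fin 3, i ≠ j ∧
    c = ‖(2 * p i - x * p j) / (4 - x ^ 2)‖}

/-- `M(μ)`, the maximum of the finite set `centerNorms` (zero if that set is empty). -/
noncomputable def centerBound (p : Fin 3 → ℂ) (s : ℂ) : ℝ := sSup (centerNorms p s)

/-- `L(μ) = max {2 + α, m, M + 1}`, for the choice `m` of the sink constant. -/
noncomputable def bigL (p : Fin 3 → ℂ) (s : ℂ) (m : ℝ) : ℝ :=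
  max (2 + alpha p) (max m (centerBound p s + 1))

/-- The BQ-conditions on a function on the regions. -/
structure SatisfiesBQ (p : Fin 3 → ℂ) (s : ℂ) (m : ℝ) (φ : Region → ℂ) : Prop where
  bq1 : ∀ X : Region, ∀ a ∈ Set.Icc (-2 : ℝ) 2, φ X ≠ (a : ℂ)
  bq2 : {X : Region | ‖φ X‖ ≤ bigL p s m}.Finite

/-! ## Well-definedness of the constants -/

theorem conicPoly_eq_det (p q r s x : ℂ) :
    conicPoly p q r s x = -4 * Matrix.det !![1, x / 2, -q / 2; x / 2, 1, -r / 2;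
      -q / 2, -r / 2, x ^ 2 - p * x - s] := by
  simp [Matrix.det_fin_three, conicPoly]
  ring

/-- If `μ = GT(a, b, c, d)`, then `S(μ)` is the set of all roots `x_{u,v}^±` of `κ_{u,v}`, where
`{u, v}` runs over the pairs taken from `a, b, c, d`. -/
theorem mem_exceptionalSet_GT (a b c d x : ℂ) :
    x ∈ exceptionalSet ![a * b + c * d, a * d + b * c, a * c + b * d]
        (4 - a ^ 2 - b ^ 2 - c ^ 2 - d ^ 2 - a * b * c * d) ↔
      kappa a b x = 0 ∨ kappa a c x = 0 ∨ kappa a d x = 0 ∨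
      kappa b c x = 0 ∨ kappa b d x = 0 ∨ kappa c d x = 0 := by
  have h0 : conicPoly (a * b + c * d) (a * d + b * c) (a * c + b * d)
      (4 - a ^ 2 - b ^ 2 - c ^ 2 - d ^ 2 - a * b * c * d) x = kappa a b x * kappa c d x := by
    simp only [conicPoly, kappa]; ring
  have h1 : conicPoly (a * d + b * c) (a * b + c * d) (a * c + b * d)
      (4 - a ^ 2 - b ^ 2 - c ^ 2 - d ^ 2 - a * b * c * d) x = kappa a d x * kappa b c x := by
    simp only [conicPoly, kappa]; ring
  have h2 : conicPoly (a * c + b * d) (a * b + c * d) (a * d + b * c)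
      (4 - a ^ 2 - b ^ 2 - c ^ 2 - d ^ 2 - a * b * c * d) x = kappa a c x * kappa b d x := by
    simp only [conicPoly, kappa]; ring
  simp only [exceptionalSet, Set.mem_ofPred_eq, Matrix.cons_val_zero, Matrix.cons_val_one,
    Matrix.cons_val]
  rw [h0, h1, h2, mul_eq_zero, mul_eq_zero, mul_eq_zero]
  tauto

theorem finite_conicPoly (p q r s : ℂ) : {x : ℂ | conicPoly p q r s x = 0}.Finite := by
  classical
  let P : Polynomial ℂ := Polynomial.X ^ 4 + (-(Polynomial.C p) * Polynomial.X ^ 3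
    - Polynomial.C (4 + s) * Polynomial.X ^ 2 - Polynomial.C (q * r - 4 * p) * Polynomial.X
    + Polynomial.C (q ^ 2 + r ^ 2 + 4 * s))
  have hP : P ≠ 0 := by
    have : P.coeff 4 = 1 := by
      simp [P, Polynomial.coeff_X_pow,
        ← Polynomial.C_neg, Polynomial.coeff_C_mul, -map_neg, -map_add, -map_sub, -map_mul, -map_pow]
    intro h
    rw [h] at this
    simp at this
  refine (P.roots.toFinset.finite_toSet).subset ?_
  intro x hx
  simp only [Finset.mem_coe, Multiset.mem_toFinset, Polynomial.mem_roots hP, Polynomial.IsRoot.def]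
  have hx' : conicPoly p q r s x = 0 := hx
  rw [← hx']
  simp only [P, conicPoly, Polynomial.eval_add, Polynomial.eval_sub, Polynomial.eval_mul,
    Polynomial.eval_neg, Polynomial.eval_pow, Polynomial.eval_X, Polynomial.eval_C]
  ring

/-- The set whose maximum is `M(μ)` is finite. -/
theorem finite_centerNorms (p : Fin 3 → ℂ) (s : ℂ) : (centerNorms p s).Finite := by
  have hS : (exceptionalSet p s).Finite :=
    (finite_conicPoly _ _ _ _).union ((finite_conicPoly _ _ _ _).union (finite_conicPoly _ _ _ _))
  refine ((hS.prod (Set.finite_univ (α := Fin 3 × Fin 3))).image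
    (fun t : ℂ × (Fin 3 × Fin 3) => ‖(2 * p t.2.1 - t.1 * p t.2.2) / (4 - t.1 ^ 2)‖)).subset ?_
  rintro c ⟨x, hx, -, -, i, j, -, rfl⟩
  exact ⟨(x, (i, j)), ⟨hx, Set.mem_univ _⟩, rfl⟩

theorem exists_region {a b : ℤ} (h : IsCoprime a b) :
    ∃ X : Region, ∃ ε : ℤ, (ε = 1 ∨ ε = -1) ∧ num X = ε * a ∧ den X = ε * b := by
  have main : ∀ a b : ℤ, IsCoprime a b → 0 < b →
      ∃ X : Region, num X = a ∧ den X = b := by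
    intro a b h hb
    have hc : a.natAbs.Coprime b.natAbs := Int.isCoprime_iff_gcd_eq_one.1 h
    refine ⟨((⟨a, b.natAbs, by omega, hc⟩ : ℚ) : OnePoint ℚ), rfl, ?_⟩
    change ((b.natAbs : ℕ) : ℤ) = b
    omega
  rcases lt_trichotomy b 0 with hb | hb | hb
  · obtain ⟨X, h1, h2⟩ := main (-a) (-b) h.neg_neg (by omega)
    exact ⟨X, -1, Or.inr rfl, by omega, by omega⟩
  · subst hb
    have hu : IsUnit a := isCoprime_zero_right.1 h
    rcases Int.isUnit_iff.1 hu with rfl | rfl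
    · exact ⟨OnePoint.infty, 1, Or.inl rfl, rfl, rfl⟩
    · exact ⟨OnePoint.infty, -1, Or.inr rfl, rfl, rfl⟩
  · obtain ⟨X, h1, h2⟩ := main a b h hb
    exact ⟨X, 1, Or.inl rfl, by omega, by omega⟩

theorem isEdge_iff (X Y : Region) : IsEdge X Y ↔
    (num X * den Y - num Y * den X = 1 ∨ num X * den Y - num Y * den X = -1) := by
  unfold IsEdge
  exact abs_eq (by norm_num)

theorem IsEdge.symm {X Y : Region} (h : IsEdge X Y) : IsEdge Y X := by
  rw [isEdge_iff] at *
  omega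

/-- Every edge ends on a region other than a given one. -/
theorem exists_edgeEnds {X Y Z : Region} (h : IsVertex X Y Z) : ∃ W, EdgeEnds X Y Z W := by
  have e := (isEdge_iff X Y).1 h.1
  have hcop : ∀ σ : ℤ, (σ = 1 ∨ σ = -1) →
      ∃ W : Region, ∃ ε : ℤ, (ε = 1 ∨ ε = -1) ∧ num W = ε * (num X + σ * num Y) ∧
        den W = ε * (den X + σ * den Y) := by
    intro σ _
    apply exists_region
    rcases e with e | e
    · exact ⟨den Y, -num Y, by linear_combination e⟩
    · exact ⟨-den Y, num Y, by linear_combination -e⟩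
  have hedge : ∀ σ : ℤ, (σ = 1 ∨ σ = -1) → ∀ W : Region, ∀ ε : ℤ, (ε = 1 ∨ ε = -1) →
      num W = ε * (num X + σ * num Y) → den W = ε * (den X + σ * den Y) → IsVertex X Y W := by
    intro σ hσ W ε hε h1 h2
    refine ⟨h.1, (isEdge_iff _ _).2 ?_, (isEdge_iff _ _).2 ?_⟩ <;> rw [h1, h2] <;>
    rcases hσ with rfl | rfl <;> rcases hε with rfl | rfl <;> rcases e with e | e <;>
      first
      | (left; linear_combination e)
      | (left; linear_combination -e)
      | (right; linear_combination e)
      | (right; linear_combination -e)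
  obtain ⟨W, ε, hε, h1, h2⟩ := hcop 1 (Or.inl rfl)
  obtain ⟨W', ε', hε', h1', h2'⟩ := hcop (-1) (Or.inr rfl)
  by_cases hZ : Z = W
  · refine ⟨W', h, hedge _ (Or.inr rfl) W' ε' hε' h1' h2', ?_⟩
    intro hW
    have hWW : W = W' := hZ.symm.trans hW
    have h3 : num W * den W' - num W' * den W = 0 := by rw [hWW]; ring
    rw [h1, h2, h1', h2'] at h3
    have h4 : ε * ε' * (num X * den Y - num Y * den X) = 0 := by linarith
    rcases hε with rfl | rfl <;> rcases hε' with rfl | rfl <;> rcases e with e | e <;>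
      rw [e] at h4 <;> norm_num at h4
  · exact ⟨W, h, hedge _ (Or.inl rfl) W ε hε h1 h2, hZ⟩

theorem sink_estimate {K : ℝ} (hK : 100 ≤ K) {p q r s x y z w : ℂ}
    (hp : ‖p‖ ≤ K) (hq : ‖q‖ ≤ K) (hr : ‖r‖ ≤ K) (hs : ‖s‖ ≤ K)
    (hv : x ^ 2 + y ^ 2 + z ^ 2 + x * y * z = p * x + q * y + r * z + s)
    (he : z + w = r - x * y) (hx : K < ‖x‖) (hy : K < ‖y‖) (hxz : ‖x‖ ≤ ‖z‖) (hyz : ‖y‖ ≤ ‖z‖) :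
    ‖w‖ < ‖z‖ := by
  have hz : K < ‖z‖ := lt_of_lt_of_le hx hxz
  have a1 : ‖x‖ * ‖y‖ * ‖z‖ ≤
      ‖p‖ * ‖x‖ + ‖q‖ * ‖y‖ + ‖r‖ * ‖z‖ + ‖s‖ + ‖x‖ ^ 2 + ‖y‖ ^ 2 + ‖z‖ ^ 2 := by
    have : x * y * z = p * x + q * y + r * z + s - x ^ 2 - y ^ 2 - z ^ 2 := by
      linear_combination hv
    calc ‖x‖ * ‖y‖ * ‖z‖ = ‖x * y * z‖ := by rw [norm_mul, norm_mul]
      _ = ‖p * x + q * y + r * z + s - x ^ 2 - y ^ 2 - z ^ 2‖ := by rw [this]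
      _ ≤ ‖p * x‖ + ‖q * y‖ + ‖r * z‖ + ‖s‖ + ‖x ^ 2‖ + ‖y ^ 2‖ + ‖z ^ 2‖ := by
        refine (norm_sub_le _ _).trans (add_le_add ((norm_sub_le _ _).trans
          (add_le_add ((norm_sub_le _ _).trans (add_le_add ?_ le_rfl)) le_rfl)) le_rfl)
        refine (norm_add_le _ _).trans (add_le_add ((norm_add_le _ _).trans
          (add_le_add (norm_add_le _ _) le_rfl)) le_rfl)
      _ = _ := by simp only [norm_mul, norm_pow]
  have a2 : ‖z‖ * ‖w‖ ≤ ‖p‖ * ‖x‖ + ‖q‖ * ‖y‖ + ‖s‖ + ‖x‖ ^ 2 + ‖y‖ ^ 2 := by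
    have : z * w = x ^ 2 + y ^ 2 - p * x - q * y - s := by
      linear_combination z * he - hv
    calc ‖z‖ * ‖w‖ = ‖z * w‖ := (norm_mul _ _).symm
      _ = ‖x ^ 2 + y ^ 2 - p * x - q * y - s‖ := by rw [this]
      _ ≤ ‖x ^ 2‖ + ‖y ^ 2‖ + ‖p * x‖ + ‖q * y‖ + ‖s‖ := by
        refine (norm_sub_le _ _).trans (add_le_add ((norm_sub_le _ _).trans
          (add_le_add ((norm_sub_le _ _).trans (add_le_add (norm_add_le _ _) le_rfl)) le_rfl))
          le_rfl)
      _ = _ := by simp only [norm_mul, norm_pow]; ring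
  generalize ‖x‖ = X at *
  generalize ‖y‖ = Y at *
  generalize ‖z‖ = Z at *
  generalize ‖w‖ = W at *
  generalize ‖p‖ = P at *
  generalize ‖q‖ = Q at *
  generalize ‖r‖ = R at *
  generalize ‖s‖ = S at *
  have hZ0 : 0 < Z := by linarith
  have b1 : P * X ≤ Z * X := mul_le_mul_of_nonneg_right (by linarith) (by linarith)
  have b2 : Q * Y ≤ Z * Y := mul_le_mul_of_nonneg_right (by linarith) (by linarith)
  have b3 : R * Z ≤ Z * Z := mul_le_mul_of_nonneg_right (by linarith) (by linarith)
  have c1 : Z * X ≤ Z * Z := mul_le_mul_of_nonneg_left hxz hZ0.le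
  have c2 : Z * Y ≤ Z * Z := mul_le_mul_of_nonneg_left hyz hZ0.le
  have c3 : S * 100 ≤ Z * Z := mul_le_mul (by linarith) (by linarith) (by norm_num) hZ0.le
  have d1 : X ^ 2 ≤ X * Z := by nlinarith
  have d2 : Y ^ 2 ≤ Y * Z := by nlinarith
  have e1 : X * Y * Z ≤ 7 * Z * Z := by nlinarith
  have e2 : X * Y ≤ 7 * Z := le_of_mul_le_mul_right e1 hZ0
  have f1 : 100 * X ≤ 7 * Z := by nlinarith
  have f2 : 100 * Y ≤ 7 * Z := by nlinarith
  have g1 : 100 * (Z * X) ≤ 7 * (Z * Z) := by nlinarith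
  have g2 : 100 * (Z * Y) ≤ 7 * (Z * Z) := by nlinarith
  have : Z * W < Z * Z := by nlinarith
  exact lt_of_mul_lt_mul_left this hZ0.le

/-- Admissible constants `m(μ) > 2` exist. -/
theorem exists_isSinkConstant (C : Region → Fin 3) (hC : IsColoring C) (p : Fin 3 → ℂ) (s : ℂ) :
    ∃ m : ℝ, 2 < m ∧ IsSinkConstant C p s m := by
  let K : ℝ := 100 + ‖p 0‖ + ‖p 1‖ + ‖p 2‖ + ‖s‖
  have n0 := norm_nonneg (p 0)
  have n1 := norm_nonneg (p 1)
  have n2 := norm_nonneg (p 2)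
  have n3 := norm_nonneg s
  have hK : 100 ≤ K := by simp only [K]; linarith
  have hp : ∀ i, ‖p i‖ ≤ K := by
    intro i
    fin_cases i <;> simp only [K] <;>
      simp only [Fin.zero_eta, Fin.mk_one, Fin.reduceFinMk] <;> linarith
  have hs : ‖s‖ ≤ K := by simp only [K]; linarith
  refine ⟨K, by linarith, ?_⟩
  intro φ hφ X Y Z hsink
  by_contra hcon
  rw [not_le, lt_min_iff, lt_min_iff] at hcon
  obtain ⟨hX, hY, hZ⟩ := hcon
  obtain ⟨hv, sZ, sX, sY⟩ := hsink
  have vrel : φ X ^ 2 + φ Y ^ 2 + φ Z ^ 2 + φ X * φ Y * φ Z =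
      p (C X) * φ X + p (C Y) * φ Y + p (C Z) * φ Z + s := by
    have c1 := hC _ _ hv.1
    have c2 := hC _ _ hv.2.1
    have c3 := hC _ _ hv.2.2
    have hvert := hφ.vertex
    have e1 := hv.1
    have e2 := hv.2.1
    have e3 := hv.2.2
    have perm : ∀ A B D : Region, IsVertex A B D → C A = 0 → C B = 1 → C D = 2 →
        φ A ^ 2 + φ B ^ 2 + φ D ^ 2 + φ A * φ B * φ D =
          p (C A) * φ A + p (C B) * φ B + p (C D) * φ D + s := by
      intro A B D h a b d
      rw [a, b, d]
      exact hvert A B D h a b d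
    have cX : C X = 0 ∨ C X = 1 ∨ C X = 2 := by generalize C X = i; revert i; decide
    have cY : C Y = 0 ∨ C Y = 1 ∨ C Y = 2 := by generalize C Y = i; revert i; decide
    have cZ : C Z = 0 ∨ C Z = 1 ∨ C Z = 2 := by generalize C Z = i; revert i; decide
    rcases cX with a | a | a <;> rcases cY with b | b | b <;> rcases cZ with d | d | d <;>
      first
      | exact absurd (a.trans b.symm) c1
      | exact absurd (b.trans d.symm) c2
      | exact absurd (a.trans d.symm) c3
      | (have h := perm X Y Z ⟨e1, e2, e3⟩ a b d
         linear_combination h)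
      | (have h := perm X Z Y ⟨e3, e2.symm, e1⟩ a d b
         linear_combination h)
      | (have h := perm Y X Z ⟨e1.symm, e3, e2⟩ b a d
         linear_combination h)
      | (have h := perm Y Z X ⟨e2, e3.symm, e1.symm⟩ b d a
         linear_combination h)
      | (have h := perm Z X Y ⟨e3.symm, e1, e2.symm⟩ d a b
         linear_combination h)
      | (have h := perm Z Y X ⟨e2.symm, e1.symm, e3.symm⟩ d b a
         linear_combination h)
  have vYZX : IsVertex Y Z X := ⟨hv.2.1, hv.2.2.symm, hv.1.symm⟩
  have vXZY : IsVertex X Z Y := ⟨hv.2.2, hv.2.1.symm, hv.1⟩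
  by_cases h1 : ‖φ X‖ ≤ ‖φ Z‖ ∧ ‖φ Y‖ ≤ ‖φ Z‖
  · obtain ⟨W, hW⟩ := exists_edgeEnds hv
    exact absurd (sZ W hW) (not_le.2 (sink_estimate hK (hp (C X)) (hp (C Y)) (hp (C Z)) hs
      vrel (hφ.edge _ _ _ _ hW) hX hY h1.1 h1.2))
  by_cases h2 : ‖φ Y‖ ≤ ‖φ X‖ ∧ ‖φ Z‖ ≤ ‖φ X‖
  · obtain ⟨W, hW⟩ := exists_edgeEnds vYZX
    exact absurd (sX W hW) (not_le.2 (sink_estimate hK (hp (C Y)) (hp (C Z)) (hp (C X)) hs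
      (by linear_combination vrel) (hφ.edge _ _ _ _ hW) hY hZ h2.1 h2.2))
  have h3 : ‖φ X‖ ≤ ‖φ Y‖ ∧ ‖φ Z‖ ≤ ‖φ Y‖ := by
    rw [not_and_or, not_le, not_le] at h1 h2
    rcases h1 with h1 | h1 <;> rcases h2 with h2 | h2 <;> constructor <;> linarith
  obtain ⟨W, hW⟩ := exists_edgeEnds vXZY
  exact absurd (sY W hW) (not_le.2 (sink_estimate hK (hp (C X)) (hp (C Z)) (hp (C Y)) hs
    (by linear_combination vrel) (hφ.edge _ _ _ _ hW) hX hZ h3.1 h3.2))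

end MarkoffTree

open MarkoffTree

/-! Measure a region by its height, the sum of the absolute values of its coprime numerator and
denominator. A region of height above 1 has two Farey parents whose heights add up to its own. The
point is that |φ| grows exponentially with the height outside a finite set of regions; the series is
then dominated by a sum of exp(-κt(|a|+|b|)) over integer vectors (a, b).

Growth has two sources. Far from the root, an edge whose two regions have values above `L` cannot
lose modulus in the outward direction: otherwise one would reach a sink with all three values above
`L ≥ m` (`norm_sub_le_norm_add`). Hence a child X of such U, V satisfies |φ(U)||φ(V)| ≤ 4|φ(X)|, so
that log(|φ|/4) is superadditive where the height is additive.

This argument fails next to the finitely many regions of small value, whose neighbours are treated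
directly. Around a region of value x the neighbours satisfy a linear recurrence with characteristic
roots l and 1/l, where |l| > 1 by (BQ1). They grow in both directions unless one mode vanishes. In
that case the conic of neighbouring values is degenerate and in one direction the neighbours
approach the coordinates of its centre, bounded by M; infinitely many values are then at most M + 1
≤ L, against (BQ2) (`exists_pow_le_norm_neighbour`).

The two sources combine in `finite_norm_le` and `exists_exp_le_norm`. -/

namespace MarkoffTree

/-! ## Regions as primitive vectors -/

/-- The region with slope the direction of the vector `(a, b)`. -/
def reg (a b : ℤ) : Region := if b = 0 then OnePoint.infty else ((a / b : ℚ) : OnePoint ℚ)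

/-- The height of a region. -/
def height (X : Region) : ℤ := |num X| + |den X|

theorem reg_neg (a b : ℤ) : reg (-a) (-b) = reg a b := by
  simp [reg, neg_div_neg_eq]

theorem reg_num_den (X : Region) : reg (num X) (den X) = X := by
  induction X using OnePoint.rec with
  | infty => rfl
  | coe q =>
    have h : reg q.num q.den = (q : OnePoint ℚ) := by
      simp [reg, Rat.num_div_den]
    exact h

theorem isCoprime_num_den (X : Region) : IsCoprime (num X) (den X) := by
  induction X using OnePoint.rec with
  | infty => exact isCoprime_one_left
  | coe q => exact Rat.isCoprime_num_den q

theorem den_nonneg (X : Region) : 0 ≤ den X := by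
  induction X using OnePoint.rec with
  | infty => exact le_rfl
  | coe q => exact Int.natCast_nonneg q.den

/-- A primitive vector and its negative give the same region, while `num` and `den` fix a sign;
later identities are checked for both signs. -/
theorem num_den_reg {a b : ℤ} (h : IsCoprime a b) :
    (num (reg a b) = a ∧ den (reg a b) = b) ∨ (num (reg a b) = -a ∧ den (reg a b) = -b) := by
  obtain ⟨X, ε, hε, h1, h2⟩ := exists_region h
  rcases hε with rfl | rfl
  · left
    have : reg a b = X := by rw [← reg_num_den X, h1, h2, one_mul, one_mul]
    rw [this, h1, h2, one_mul, one_mul]; exact ⟨rfl, rfl⟩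
  · right
    have : reg a b = X := by rw [← reg_num_den X, h1, h2, neg_one_mul, neg_one_mul, reg_neg]
    rw [this, h1, h2, neg_one_mul, neg_one_mul]; exact ⟨rfl, rfl⟩

theorem height_reg {a b : ℤ} (h : IsCoprime a b) : height (reg a b) = |a| + |b| := by
  rcases num_den_reg h with ⟨h1, h2⟩ | ⟨h1, h2⟩ <;> simp [height, h1, h2]

theorem isCoprime_left_of_det {a b c d : ℤ} (h : a * d - c * b = 1) : IsCoprime a b :=
  ⟨d, -c, by linear_combination h⟩

theorem isCoprime_right_of_det {a b c d : ℤ} (h : a * d - c * b = 1) : IsCoprime c d :=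
  ⟨-b, a, by linear_combination h⟩

theorem isEdge_reg {a b c d : ℤ} (h : a * d - c * b = 1) : IsEdge (reg a b) (reg c d) := by
  rw [isEdge_iff]
  rcases num_den_reg (isCoprime_left_of_det h) with ⟨h1, h2⟩ | ⟨h1, h2⟩ <;>
  rcases num_den_reg (isCoprime_right_of_det h) with ⟨h3, h4⟩ | ⟨h3, h4⟩ <;>
  rw [h1, h2, h3, h4] <;>
  first
  | (left; linear_combination h)
  | (right; linear_combination -h)

theorem isVertex_reg_add {a b c d : ℤ} (h : a * d - c * b = 1) :
    IsVertex (reg a b) (reg c d) (reg (a + c) (b + d)) :=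
  ⟨isEdge_reg h, (isEdge_reg (by linear_combination h)).symm, isEdge_reg (by linear_combination h)⟩

theorem isVertex_reg_sub {a b c d : ℤ} (h : a * d - c * b = 1) :
    IsVertex (reg a b) (reg c d) (reg (a - c) (b - d)) :=
  ⟨isEdge_reg h, (isEdge_reg (by linear_combination h)).symm,
    (isEdge_reg (by linear_combination h)).symm⟩

theorem reg_sub_ne_reg_add {a b c d : ℤ} (h : a * d - c * b = 1) :
    reg (a - c) (b - d) ≠ reg (a + c) (b + d) := by
  intro he
  have c1 : IsCoprime (a - c) (b - d) := ⟨d, -c, by linear_combination h⟩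
  have c2 : IsCoprime (a + c) (b + d) := ⟨d, -c, by linear_combination h⟩
  have e : (a - c) * (b + d) - (a + c) * (b - d) = 0 := by
    rcases num_den_reg c1 with ⟨h1, h2⟩ | ⟨h1, h2⟩ <;>
    rcases num_den_reg c2 with ⟨h3, h4⟩ | ⟨h3, h4⟩ <;>
    rw [he] at h1 h2 <;> rw [h1] at h3 <;> rw [h2] at h4
    · rw [h3, h4]; ring
    · rw [h3, h4]; ring
    · rw [neg_eq_iff_eq_neg.1 h3, neg_eq_iff_eq_neg.1 h4]; ring
    · rw [neg_inj.1 h3, neg_inj.1 h4]; ring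
  have : 2 * (a * d - c * b) = 0 := by linear_combination e
  omega

theorem edgeEnds_reg {a b c d : ℤ} (h : a * d - c * b = 1) :
    EdgeEnds (reg a b) (reg c d) (reg (a - c) (b - d)) (reg (a + c) (b + d)) :=
  ⟨isVertex_reg_sub h, isVertex_reg_add h, reg_sub_ne_reg_add h⟩

theorem EdgeEnds.swap {X Y Z W : Region} (h : EdgeEnds X Y Z W) : EdgeEnds X Y W Z :=
  ⟨h.2.1, h.1, h.2.2.symm⟩

theorem EdgeEnds.comm {X Y Z W : Region} (h : EdgeEnds X Y Z W) : EdgeEnds Y X Z W :=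
  ⟨⟨h.1.1.symm, h.1.2.2, h.1.2.1⟩, ⟨h.2.1.1.symm, h.2.1.2.2, h.2.1.2.1⟩, h.2.2⟩

/-- The two Farey parents of a region, with their heights adding up. -/
theorem exists_parents {X : Region} (hX : 1 < height X) : ∃ a b c d : ℤ,
    a * d - c * b = 1 ∧ 0 ≤ a * c ∧ 0 ≤ b * d ∧ reg (a + c) (b + d) = X := by
  obtain ⟨x, y, hxy⟩ := isCoprime_num_den X
  have hd0 := den_nonneg X
  have hr := reg_num_den X
  unfold height at hX
  generalize num X = n at *
  generalize den X = k at *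
  have hn0 : n ≠ 0 := by
    rintro rfl
    have : IsUnit k := IsUnit.of_mul_eq_one y (by linear_combination hxy)
    rcases Int.isUnit_iff.1 this with rfl | rfl <;> norm_num at hX
  have hk0 : 0 < k := by
    rcases hd0.lt_or_eq with h | h
    · exact h
    subst h
    have : IsUnit n := IsUnit.of_mul_eq_one x (by linear_combination hxy)
    rcases Int.isUnit_iff.1 this with rfl | rfl <;> norm_num at hX
  -- The vectors of determinant 1 with (n, k) form the line (y, -x) + j(n, k); a parent is a point
  -- of it lying between 0 and (n, k) in both coordinates.
  have main : ∀ j : ℤ, 0 ≤ -x + j * k → -x + j * k ≤ k →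
      0 ≤ (y + j * n) * (n - (y + j * n)) → ∃ a b c d : ℤ,
      a * d - c * b = 1 ∧ 0 ≤ a * c ∧ 0 ≤ b * d ∧ reg (a + c) (b + d) = X := by
    intro j h1 h2 h3
    refine ⟨y + j * n, -x + j * k, n - (y + j * n), k - (-x + j * k), by linear_combination hxy,
      h3, mul_nonneg h1 (by linarith), ?_⟩
    rw [← hr]; congr 1 <;> ring
  -- The second coordinate is reduced modulo k, into [1, k] for n < 0 and [0, k - 1] for n > 0; the
  -- determinant then places the first one between 0 and n. The excluded endpoint would fail when k
  -- = 1.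
  rcases lt_or_gt_of_ne hn0 with hn | hn
  · have e := Int.emod_add_mul_ediv (-x - 1) k
    have e1 := Int.emod_nonneg (-x - 1) hk0.ne'
    have e2 := Int.emod_lt_of_pos (-x - 1) hk0
    set j := -((-x - 1) / k) with hj
    have e3 : -x + j * k = (-x - 1) % k + 1 := by rw [hj]; linear_combination -e
    refine main j (by omega) (by omega) ?_
    have i1 : 1 ≤ -x + j * k := by omega
    have i2 : -x + j * k ≤ k := by omega
    have det : (y + j * n) * k = 1 + (-x + j * k) * n := by linear_combination hxy
    have j1 : y + j * n ≤ 0 := by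
      by_contra hc
      have : 1 ≤ y + j * n := by omega
      nlinarith
    have j2 : n ≤ y + j * n := by
      by_contra hc
      have : y + j * n + 1 ≤ n := by omega
      nlinarith
    exact mul_nonneg_of_nonpos_of_nonpos j1 (by omega)
  · have e := Int.emod_add_mul_ediv (-x) k
    have e1 := Int.emod_nonneg (-x) hk0.ne'
    have e2 := Int.emod_lt_of_pos (-x) hk0
    set j := -((-x) / k) with hj
    have e3 : -x + j * k = (-x) % k := by rw [hj]; linear_combination -e
    refine main j (by omega) (by omega) ?_
    have i1 : 0 ≤ -x + j * k := by omega
    have i2 : -x + j * k + 1 ≤ k := by omega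
    have det : (y + j * n) * k = 1 + (-x + j * k) * n := by linear_combination hxy
    have j1 : 0 ≤ y + j * n := by
      by_contra hc
      have : y + j * n + 1 ≤ 0 := by omega
      nlinarith
    have j2 : y + j * n ≤ n := by
      by_contra hc
      have : n + 1 ≤ y + j * n := by omega
      nlinarith
    exact mul_nonneg j1 (by omega)

theorem abs_add_of_mul_nonneg {a c : ℤ} (h : 0 ≤ a * c) : |a + c| = |a| + |c| := by
  rw [abs_add_eq_add_abs_iff]
  rcases mul_nonneg_iff.1 h with h | h
  · exact Or.inl h
  · exact Or.inr h

theorem height_reg_add {a b c d : ℤ} (h : a * d - c * b = 1) (h1 : 0 ≤ a * c) (h2 : 0 ≤ b * d) :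
    height (reg (a + c) (b + d)) = height (reg a b) + height (reg c d) := by
  rw [height_reg (isCoprime_left_of_det h), height_reg (isCoprime_right_of_det h),
    height_reg (a := a + c) (b := b + d) ⟨d, -c, by linear_combination h⟩,
    abs_add_of_mul_nonneg h1, abs_add_of_mul_nonneg h2]
  ring

theorem height_pos (X : Region) : 0 < height X := by
  have h := isCoprime_num_den X
  unfold height
  have h1 := abs_nonneg (num X)
  have h2 := abs_nonneg (den X)
  by_contra hc
  have e1 : num X = 0 := abs_eq_zero.1 (by omega)
  have e2 : den X = 0 := abs_eq_zero.1 (by omega)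
  rw [e1, e2] at h
  exact not_isCoprime_zero_zero h

theorem finite_height_le (B : ℤ) : {X : Region | height X ≤ B}.Finite := by
  have hf : (Set.Icc (-B) B ×ˢ Set.Icc (-B) B).Finite :=
    (Set.finite_Icc _ _).prod (Set.finite_Icc _ _)
  refine (hf.image (fun v : ℤ × ℤ => reg v.1 v.2)).subset ?_
  intro X hX
  refine ⟨(num X, den X), ?_, reg_num_den X⟩
  have hX' : |num X| + |den X| ≤ B := hX
  have h1 := abs_nonneg (num X)
  have h2 := abs_nonneg (den X)
  exact ⟨abs_le.1 (by linarith), abs_le.1 (by linarith)⟩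

theorem exists_height_le_of_finite {S : Set Region} (hS : S.Finite) :
    ∃ B : ℤ, ∀ X ∈ S, height X ≤ B := by
  obtain ⟨B, hB⟩ := (hS.image height).bddAbove
  exact ⟨B, fun X hX => hB ⟨X, hX, rfl⟩⟩

/-! ## Edges of a Markoff map pointing towards the root -/

theorem norm_le_two_alpha (p : Fin 3 → ℂ) (i : Fin 3) : ‖p i‖ ≤ 2 * alpha p := by
  unfold alpha
  rw [mul_div_cancel₀ _ two_ne_zero]
  fin_cases i
  · exact le_max_left _ _
  · exact (le_max_left _ _).trans (le_max_right _ _)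
  · exact (le_max_right _ _).trans (le_max_right _ _)

theorem norm_mul_le_of_edge {x y z w P : ℂ} (h : z + w = P - x * y) :
    ‖x‖ * ‖y‖ ≤ ‖z‖ + ‖w‖ + ‖P‖ := by
  have e : x * y = P - (z + w) := by linear_combination h
  calc ‖x‖ * ‖y‖ = ‖P - (z + w)‖ := by rw [← norm_mul, e]
    _ ≤ ‖P‖ + ‖z + w‖ := norm_sub_le _ _
    _ ≤ ‖P‖ + (‖z‖ + ‖w‖) := by gcongr; exact norm_add_le _ _
    _ = _ := by ring

/-- The amount by which `|φ|` grows across an edge whose two regions have values above `L`. -/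
noncomputable def gain (L : ℝ) : ℝ := (L - 2) ^ 2 / 2

/-- As z is the larger end, 2‖z‖ ≥ ‖x‖‖y‖ - 2(L - 2), whence ‖z‖ - ‖y‖ ≥ ‖y‖(‖x‖ - 2)/2 - (L - 2) ≥
L(L - 2)/2 - (L - 2). -/
theorem add_gain_le {L : ℝ} (hL : 2 < L) {x y z w P : ℂ} (hP : ‖P‖ ≤ 2 * (L - 2))
    (h : z + w = P - x * y) (hzw : ‖w‖ ≤ ‖z‖) (hx : L < ‖x‖) (hy : L < ‖y‖) :
    ‖y‖ + gain L ≤ ‖z‖ := by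
  have := norm_mul_le_of_edge h
  unfold gain
  nlinarith [mul_pos (sub_pos.2 hx) (sub_pos.2 hy), mul_pos (sub_pos.2 hL) (sub_pos.2 hy),
    mul_pos (sub_pos.2 hL) (sub_pos.2 hx)]

/-- The constant term is absorbed because ‖x‖‖y‖ > L² > 4(L - 2). -/
theorem mul_le_four_mul {L : ℝ} (hL : 2 < L) {x y z w P : ℂ} (hP : ‖P‖ ≤ 2 * (L - 2))
    (h : z + w = P - x * y) (hzw : ‖w‖ ≤ ‖z‖) (hx : L < ‖x‖) (hy : L < ‖y‖) :
    ‖x‖ * ‖y‖ ≤ 4 * ‖z‖ := by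
  have := norm_mul_le_of_edge h
  nlinarith [mul_pos (sub_pos.2 hx) (sub_pos.2 hy), mul_pos (sub_pos.2 hL) (sub_pos.2 hy),
    mul_pos (sub_pos.2 hL) (sub_pos.2 hx)]

/-- The edge relation determines the value across an edge, so uniqueness of the opposite region is
not needed to verify a sink. -/
theorem IsMarkoffMap.eq_of_edgeEnds {C : Region → Fin 3} {p : Fin 3 → ℂ} {s : ℂ} {φ : Region → ℂ}
    (hφ : IsMarkoffMap C p s φ) {X Y Z W W' : Region} (h : EdgeEnds X Y Z W)
    (h' : EdgeEnds X Y Z W') : φ W = φ W' := by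
  linear_combination hφ.edge _ _ _ _ h - hφ.edge _ _ _ _ h'

/-- Far from the root, and away from the regions of small value, `|φ|` does not decrease when an
edge is crossed in the direction away from the root. -/
theorem norm_sub_le_norm_add {C : Region → Fin 3} {p : Fin 3 → ℂ} {s : ℂ} {φ : Region → ℂ}
    {m L : ℝ} (hm : IsSinkConstant C p s m) (hφ : IsMarkoffMap C p s φ) (hL : 2 < L) (hmL : m ≤ L)
    (hα : alpha p ≤ L - 2) {B : ℤ} (hB : ∀ X, ‖φ X‖ ≤ L → height X ≤ B) (n : ℕ) :
    ∀ a b c d : ℤ, a * d - c * b = 1 → 0 ≤ a * c → 0 ≤ b * d →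
      B < height (reg a b) + height (reg c d) → L < ‖φ (reg a b)‖ → L < ‖φ (reg c d)‖ →
      ‖φ (reg (a - c) (b - d))‖ ≤ n * gain L →
      ‖φ (reg (a - c) (b - d))‖ ≤ ‖φ (reg (a + c) (b + d))‖ := by
  have hp : ∀ i, ‖p i‖ ≤ 2 * (L - 2) := fun i => (norm_le_two_alpha p i).trans (by linarith)
  induction n with
  | zero =>
    intro a b c d _ _ _ _ _ _ h
    have : ‖φ (reg (a - c) (b - d))‖ ≤ 0 := by simpa using h
    exact this.trans (norm_nonneg _)
  | succ n ih =>
    intro a b c d hdet hac hbd hB' hu hv hn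
    by_contra hlt
    rw [not_le] at hlt
    have hsum := height_reg_add hdet hac hbd
    have hpu := height_pos (reg a b)
    have hpv := height_pos (reg c d)
    have hX : L < ‖φ (reg (a + c) (b + d))‖ := by
      by_contra hc
      have := hB _ (not_lt.1 hc)
      omega
    have e0 := edgeEnds_reg hdet
    have rel := hφ.edge _ _ _ _ e0
    -- If the modulus drops outwards, the inner region exceeds both sides of the edge by the gain.
    -- These sides are the inner regions of the next two edges, so the induction parameter falls by
    -- one.
    have g1 := add_gain_le hL (hp _) rel hlt.le hu hv
    have g2 := add_gain_le hL (hp _) (rel.trans (by ring_nf)) hlt.le hv hu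
    push_cast at hn
    have hdet1 : a * (b + d) - (a + c) * b = 1 := by linear_combination hdet
    have hdet2 : (a + c) * d - c * (b + d) = 1 := by linear_combination hdet
    have e1 : EdgeEnds (reg a b) (reg (a + c) (b + d)) (reg c d)
        (reg (a + (a + c)) (b + (b + d))) := by
      have := edgeEnds_reg hdet1
      rwa [show a - (a + c) = -c by ring, show b - (b + d) = -d by ring, reg_neg] at this
    have e2 : EdgeEnds (reg (a + c) (b + d)) (reg c d) (reg a b)
        (reg (a + c + c) (b + d + d)) := by
      have := edgeEnds_reg hdet2
      rwa [show a + c - c = a by ring, show b + d - d = b by ring] at this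
    have f1 : ‖φ (reg c d)‖ ≤ ‖φ (reg (a + (a + c)) (b + (b + d)))‖ := by
      have := ih a b (a + c) (b + d) hdet1
        (by nlinarith [mul_self_nonneg a]) (by nlinarith [mul_self_nonneg b]) (by omega) hu hX
      rw [show a - (a + c) = -c by ring, show b - (b + d) = -d by ring, reg_neg] at this
      exact this (by linarith)
    have f2 : ‖φ (reg a b)‖ ≤ ‖φ (reg (a + c + c) (b + d + d))‖ := by
      have := ih (a + c) (b + d) c d hdet2
        (by nlinarith [mul_self_nonneg c]) (by nlinarith [mul_self_nonneg d]) (by omega) hX hv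
      rw [show a + c - c = a by ring, show b + d - d = b by ring] at this
      exact this (by linarith)
    -- The assumed drop on one edge and the induction hypothesis on the other two make this vertex a
    -- sink with all values above `L`.
    have hsink : IsSink φ (reg a b) (reg c d) (reg (a + c) (b + d)) := by
      refine ⟨isVertex_reg_add hdet, fun W hW => ?_, fun W hW => ?_, fun W hW => ?_⟩
      · rw [hφ.eq_of_edgeEnds hW e0.swap]; exact hlt.le
      · rw [hφ.eq_of_edgeEnds hW e2.comm]; exact f2
      · rw [hφ.eq_of_edgeEnds hW e1]; exact f1
    have := hm φ hφ _ _ _ hsink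
    have : L < min ‖φ (reg a b)‖ (min ‖φ (reg c d)‖ ‖φ (reg (a + c) (b + d))‖) :=
      lt_min hu (lt_min hv hX)
    linarith

theorem gain_pos {L : ℝ} (hL : 2 < L) : 0 < gain L := by
  unfold gain
  have := sub_pos.2 hL
  positivity

/-- A region far from the root is a neighbour of a region of small value, or its value dominates
those of its two parents. -/
theorem exists_parents_of_lt_height {C : Region → Fin 3} {p : Fin 3 → ℂ} {s : ℂ} {φ : Region → ℂ}
    {m L : ℝ} (hm : IsSinkConstant C p s m) (hφ : IsMarkoffMap C p s φ) (hL : 2 < L) (hmL : m ≤ L)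
    (hα : alpha p ≤ L - 2) {B : ℤ} (hB : ∀ X, ‖φ X‖ ≤ L → height X ≤ B) {X : Region}
    (hX1 : 1 < height X) (hX : B < height X) :
    ∃ U V : Region, IsEdge U X ∧ IsEdge V X ∧ height X = height U + height V ∧
      (L < ‖φ U‖ → L < ‖φ V‖ → ‖φ U‖ + gain L ≤ ‖φ X‖ ∧ ‖φ V‖ + gain L ≤ ‖φ X‖ ∧
        ‖φ U‖ * ‖φ V‖ ≤ 4 * ‖φ X‖) := by
  have hp : ∀ i, ‖p i‖ ≤ 2 * (L - 2) := fun i => (norm_le_two_alpha p i).trans (by linarith)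
  obtain ⟨a, b, c, d, hdet, hac, hbd, rfl⟩ := exists_parents hX1
  have hh := height_reg_add hdet hac hbd
  have hv := isVertex_reg_add hdet
  refine ⟨reg a b, reg c d, hv.2.2, hv.2.1, hh, fun hU hV => ?_⟩
  obtain ⟨n, hn⟩ := exists_nat_ge (‖φ (reg (a - c) (b - d))‖ / gain L)
  have hle := norm_sub_le_norm_add hm hφ hL hmL hα hB n a b c d hdet hac hbd (by omega) hU hV
    ((div_le_iff₀ (gain_pos hL)).1 hn)
  have rel := hφ.edge _ _ _ _ (edgeEnds_reg hdet).swap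
  exact ⟨add_gain_le hL (hp _) (rel.trans (by ring_nf)) hle hV hU, add_gain_le hL (hp _) rel hle hU hV,
    mul_le_four_mul hL (hp _) rel hle hU hV⟩

/-! ## The linear recurrence along the boundary of a region -/

/-- The roots of T² + xT + 1 have product 1. If they lay on the unit circle they would be conjugate,
and x = -2 Re l would be in [-2, 2]. -/
theorem exists_root_of_not_mem_Icc {x : ℂ} (hx : ∀ a ∈ Set.Icc (-2 : ℝ) 2, x ≠ (a : ℂ)) :
    ∃ l μ : ℂ, 1 < ‖l‖ ∧ l * μ = 1 ∧ l + μ = -x := by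
  obtain ⟨w, hw⟩ := IsAlgClosed.exists_pow_nat_eq (x ^ 2 - 4) (n := 2) (by norm_num)
  have hprod : ((-x + w) / 2) * ((-x - w) / 2) = 1 := by linear_combination -hw / 4
  have hsum : (-x + w) / 2 + (-x - w) / 2 = -x := by ring
  generalize (-x + w) / 2 = l at *
  generalize (-x - w) / 2 = μ at *
  have hn : ‖l‖ * ‖μ‖ = 1 := by rw [← norm_mul, hprod, norm_one]
  rcases lt_trichotomy ‖l‖ 1 with h | h | h
  · refine ⟨μ, l, ?_, by rw [mul_comm, hprod], by rw [add_comm, hsum]⟩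
    by_contra hc
    nlinarith [norm_nonneg l, norm_nonneg μ]
  · exfalso
    have hμ : μ = (starRingEnd ℂ) l := by
      rw [← Complex.inv_eq_conj h]
      exact (eq_inv_of_mul_eq_one_right hprod)
    have hre := abs_le.1 ((Complex.abs_re_le_norm l).trans h.le)
    refine hx (-(2 * l.re)) ⟨by linarith [hre.2], by linarith [hre.1]⟩ ?_
    rw [hμ, Complex.add_conj] at hsum
    rw [Complex.ofReal_neg, hsum, neg_neg]
  · exact ⟨l, μ, h, hprod, hsum⟩

/-- The recurrence factors as (S - l)(S - μ)d = 0 with S the shift, so (S - μ)d is geometric of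
ratio l. -/
theorem sub_mul_eq_zpow_of_recurrence {x l μ : ℂ} {d : ℤ → ℂ}
    (hd : ∀ n, d (n + 2) + d n = -x * d (n + 1)) (hprod : l * μ = 1) (hsum : l + μ = -x) (n : ℤ) :
    d (n + 1) - μ * d n = (d 1 - μ * d 0) * l ^ n := by
  have hl : l ≠ 0 := left_ne_zero_of_mul_eq_one hprod
  have step : ∀ k, d (k + 2) - μ * d (k + 1) = l * (d (k + 1) - μ * d k) := by
    intro k
    linear_combination hd k - d (k + 1) * hsum + d k * hprod
  induction n using Int.induction_on with
  | zero => simp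
  | succ k ih =>
    rw [zpow_add_one₀ hl, add_assoc, show (1 : ℤ) + 1 = 2 by norm_num, step, ih]; ring
  | pred k ih =>
    have := step (-k - 1)
    rw [show -(k : ℤ) - 1 + 2 = -k + 1 by ring, show -(k : ℤ) - 1 + 1 = -k by ring, ih] at this
    rw [show -(k : ℤ) - 1 + 1 = -k by ring, zpow_sub_one₀ hl, ← mul_assoc, this]
    field_simp

theorem exists_mul_pow_lt_one {r : ℝ} (hr0 : 0 ≤ r) (hr : r < 1) (K : ℝ) :
    ∃ n₀ : ℕ, ∀ n : ℕ, n₀ ≤ n → K * r ^ n ≤ 1 := by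
  have h := (tendsto_pow_atTop_nhds_zero_of_lt_one hr0 hr).const_mul K
  rw [mul_zero] at h
  exact Filter.eventually_atTop.1 (h.eventually (eventually_le_nhds one_pos))

/-- A solution of the recurrence grows exponentially in both directions, or else it decays in one
direction and a quadratic form vanishes. -/
theorem growth_or_decay_of_recurrence {x : ℂ} (hx : ∀ a ∈ Set.Icc (-2 : ℝ) 2, x ≠ (a : ℂ))
    {d : ℤ → ℂ} (hd : ∀ n, d (n + 2) + d n = -x * d (n + 1)) :
    (∃ r c K : ℝ, 1 < r ∧ 0 < c ∧ ∀ n : ℤ, c * r ^ n.natAbs - K ≤ ‖d n‖) ∨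
    (d 0 ^ 2 + d 1 ^ 2 + x * d 0 * d 1 = 0 ∧ ∃ σ : ℤ, σ ≠ 0 ∧
      ∃ n₀ : ℕ, ∀ n : ℕ, n₀ ≤ n → ‖d (σ * n)‖ ≤ 1) := by
  obtain ⟨l, μ, hl, hprod, hsum⟩ := exists_root_of_not_mem_Icc hx
  have ha := sub_mul_eq_zpow_of_recurrence hd hprod hsum
  have hb := sub_mul_eq_zpow_of_recurrence hd ((mul_comm _ _).trans hprod)
    ((add_comm _ _).trans hsum)
  -- The quadratic form is the product of the two mode amplitudes: a drives growth at +∞, b at -∞,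
  -- and it vanishes exactly when one of them does.
  have hab : (d 1 - μ * d 0) * (d 1 - l * d 0) = d 0 ^ 2 + d 1 ^ 2 + x * d 0 * d 1 := by
    linear_combination d 0 ^ 2 * hprod - d 0 * d 1 * hsum
  generalize d 1 - μ * d 0 = a at *
  generalize d 1 - l * d 0 = b at *
  have hl0 : l ≠ 0 := left_ne_zero_of_mul_eq_one hprod
  have hμl : μ = l⁻¹ := eq_inv_of_mul_eq_one_right hprod
  have hμ : ‖μ‖ = ‖l‖⁻¹ := by rw [hμl, norm_inv]
  have hμ1 : ‖μ‖ < 1 := by rw [hμ]; exact inv_lt_one_of_one_lt₀ hl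
  have hD : 0 < ‖l - μ‖ := by
    rw [norm_pos_iff, sub_ne_zero]
    rintro h
    rw [h] at hl
    linarith
  have key : ∀ n : ℤ, ‖a * l ^ n - b * μ ^ n‖ = ‖l - μ‖ * ‖d n‖ := by
    intro n
    rw [← norm_mul]
    congr 1
    linear_combination hb n - ha n
  have key1 : ∀ n : ℕ, ‖a * l ^ n - b * μ ^ n‖ = ‖l - μ‖ * ‖d n‖ := by
    intro n
    have := key n
    rwa [zpow_natCast, zpow_natCast] at this
  have key2 : ∀ n : ℕ, ‖b * l ^ n - a * μ ^ n‖ = ‖l - μ‖ * ‖d (-n)‖ := by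
    intro n
    have := key (-n)
    rwa [hμl, inv_zpow', neg_neg, zpow_neg, ← inv_zpow, zpow_natCast, zpow_natCast, ← hμl,
      norm_sub_rev] at this
  by_cases ha0 : a = 0
  · right
    refine ⟨by rw [← hab, ha0, zero_mul], 1, one_ne_zero, ?_⟩
    obtain ⟨n₀, h⟩ := exists_mul_pow_lt_one (norm_nonneg μ) hμ1 (‖b‖ / ‖l - μ‖)
    refine ⟨n₀, fun n hn => le_trans (le_of_eq ?_) (h n hn)⟩
    have := key1 n
    rw [ha0, zero_mul, zero_sub, norm_neg, norm_mul, norm_pow] at this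
    rw [one_mul, div_mul_eq_mul_div, this, mul_div_cancel_left₀ _ hD.ne']
  by_cases hb0 : b = 0
  · right
    refine ⟨by rw [← hab, hb0, mul_zero], -1, by norm_num, ?_⟩
    obtain ⟨n₀, h⟩ := exists_mul_pow_lt_one (norm_nonneg μ) hμ1 (‖a‖ / ‖l - μ‖)
    refine ⟨n₀, fun n hn => le_trans (le_of_eq ?_) (h n hn)⟩
    have := key2 n
    rw [hb0, zero_mul, zero_sub, norm_neg, norm_mul, norm_pow] at this
    rw [neg_one_mul, div_mul_eq_mul_div, this, mul_div_cancel_left₀ _ hD.ne']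
  left
  have ha1 := norm_pos_iff.2 ha0
  have hb1 := norm_pos_iff.2 hb0
  have est : ∀ (u v : ℂ) (n : ℕ), min ‖a‖ ‖b‖ ≤ ‖u‖ → ‖v‖ ≤ ‖a‖ + ‖b‖ →
      min ‖a‖ ‖b‖ * ‖l‖ ^ n - (‖a‖ + ‖b‖) ≤ ‖u * l ^ n - v * μ ^ n‖ := by
    intro u v n hu hv
    refine le_trans ?_ (norm_sub_norm_le _ _)
    rw [norm_mul, norm_mul, norm_pow, norm_pow]
    have h1 := mul_le_mul_of_nonneg_right hu (pow_nonneg (norm_nonneg l) n)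
    have h2 : ‖v‖ * ‖μ‖ ^ n ≤ ‖v‖ :=
      mul_le_of_le_one_right (norm_nonneg v) (pow_le_one₀ (norm_nonneg μ) hμ1.le)
    linarith
  refine ⟨‖l‖, min ‖a‖ ‖b‖ / ‖l - μ‖, (‖a‖ + ‖b‖) / ‖l - μ‖, hl, div_pos (lt_min ha1 hb1) hD, ?_⟩
  intro n
  rw [div_mul_eq_mul_div, ← sub_div, div_le_iff₀ hD, mul_comm ‖d n‖]
  rcases Int.natAbs_eq n with h | h
  · rw [h, ← key1, Int.natAbs_natCast]
    exact est a b _ (min_le_left _ _) (by linarith)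
  · rw [h, ← key2, Int.natAbs_neg, Int.natAbs_natCast]
    exact est b a _ (min_le_right _ _) (by linarith)

/-! ## The neighbours of a region -/

theorem fin_three_eq {i j k l : Fin 3} (hij : i ≠ j) (hik : i ≠ k) (hjk : j ≠ k) (hil : i ≠ l)
    (hjl : j ≠ l) : k = l := by
  omega

theorem IsColoring.eq_of_edgeEnds {C : Region → Fin 3} (hC : IsColoring C) {X Y Z W : Region}
    (h : EdgeEnds X Y Z W) : C Z = C W :=
  fin_three_eq (hC _ _ h.1.1) (hC _ _ h.1.2.2) (hC _ _ h.1.2.1) (hC _ _ h.2.1.2.2)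
    (hC _ _ h.2.1.2.1)

/-- The vertex relation, without reference to the order of the colours. -/
theorem IsMarkoffMap.vertex_relation {C : Region → Fin 3} (hC : IsColoring C) {p : Fin 3 → ℂ}
    {s : ℂ} {φ : Region → ℂ} (hφ : IsMarkoffMap C p s φ) {X Y Z : Region} (hv : IsVertex X Y Z) :
    φ X ^ 2 + φ Y ^ 2 + φ Z ^ 2 + φ X * φ Y * φ Z =
      p (C X) * φ X + p (C Y) * φ Y + p (C Z) * φ Z + s := by
  have c1 := hC _ _ hv.1
  have c2 := hC _ _ hv.2.1
  have c3 := hC _ _ hv.2.2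
  obtain ⟨e1, e2, e3⟩ := hv
  have perm : ∀ A B D : Region, IsVertex A B D → C A = 0 → C B = 1 → C D = 2 →
      φ A ^ 2 + φ B ^ 2 + φ D ^ 2 + φ A * φ B * φ D =
        p (C A) * φ A + p (C B) * φ B + p (C D) * φ D + s := by
    intro A B D h a b d
    rw [a, b, d]
    exact hφ.vertex A B D h a b d
  have cases3 : ∀ i : Fin 3, i = 0 ∨ i = 1 ∨ i = 2 := by decide
  rcases cases3 (C X) with a | a | a <;> rcases cases3 (C Y) with b | b | b <;>
    rcases cases3 (C Z) with d | d | d <;>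
    first
    | exact absurd (a.trans b.symm) c1
    | exact absurd (b.trans d.symm) c2
    | exact absurd (a.trans d.symm) c3
    | (have h := perm X Y Z ⟨e1, e2, e3⟩ a b d; linear_combination h)
    | (have h := perm X Z Y ⟨e3, e2.symm, e1⟩ a d b; linear_combination h)
    | (have h := perm Y X Z ⟨e1.symm, e3, e2⟩ b a d; linear_combination h)
    | (have h := perm Y Z X ⟨e2, e3.symm, e1.symm⟩ b d a; linear_combination h)
    | (have h := perm Z X Y ⟨e3.symm, e1, e2.symm⟩ d a b; linear_combination h)
    | (have h := perm Z Y X ⟨e2.symm, e1.symm, e3.symm⟩ d b a; linear_combination h)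

theorem mem_exceptionalSet_of_conicPoly {p : Fin 3 → ℂ} {s x : ℂ} {i j k : Fin 3} (hij : i ≠ j)
    (hik : i ≠ k) (hjk : j ≠ k) (h : conicPoly (p i) (p j) (p k) s x = 0) :
    x ∈ exceptionalSet p s := by
  have h' : conicPoly (p i) (p k) (p j) s x = 0 := by
    rw [← h]; unfold conicPoly; ring
  change _ ∨ _ ∨ _
  have cases3 : ∀ i : Fin 3, i = 0 ∨ i = 1 ∨ i = 2 := by decide
  rcases cases3 i with rfl | rfl | rfl <;> rcases cases3 j with rfl | rfl | rfl <;>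
    rcases cases3 k with rfl | rfl | rfl <;>
    first
    | exact absurd rfl hij
    | exact absurd rfl hik
    | exact absurd rfl hjk
    | exact Or.inl h
    | exact Or.inl h'
    | exact Or.inr (Or.inl h)
    | exact Or.inr (Or.inl h')
    | exact Or.inr (Or.inr h)
    | exact Or.inr (Or.inr h')

theorem norm_center_le {p : Fin 3 → ℂ} {s x : ℂ} (hx : x ∈ exceptionalSet p s) (h1 : x ≠ 2)
    (h2 : x ≠ -2) {i j : Fin 3} (hij : i ≠ j) :
    ‖(2 * p i - x * p j) / (4 - x ^ 2)‖ ≤ centerBound p s :=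
  le_csSup (finite_centerNorms p s).bddAbove ⟨x, hx, h1, h2, i, j, hij, rfl⟩

/-- The value of the conic at its centre. -/
theorem centered_conic {x y z p q r s : ℂ} (hx : 4 - x ^ 2 ≠ 0)
    (h : x ^ 2 + y ^ 2 + z ^ 2 + x * y * z = p * x + q * y + r * z + s) :
    (4 - x ^ 2) * ((y - (2 * q - x * r) / (4 - x ^ 2)) ^ 2 +
      (z - (2 * r - x * q) / (4 - x ^ 2)) ^ 2 +
      x * (y - (2 * q - x * r) / (4 - x ^ 2)) * (z - (2 * r - x * q) / (4 - x ^ 2))) =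
      conicPoly p q r s x := by
  unfold conicPoly
  field_simp
  linear_combination (4 - x ^ 2) ^ 2 * h

theorem reg_add_mul_injective {a b c d : ℤ} (h : a * d - c * b = 1) :
    Function.Injective fun n : ℤ => reg (c + n * a) (d + n * b) := by
  intro n n' he
  have cop : ∀ k : ℤ, IsCoprime (c + k * a) (d + k * b) := fun k =>
    ⟨-b, a, by linear_combination h⟩
  have he' : reg (c + n * a) (d + n * b) = reg (c + n' * a) (d + n' * b) := he
  have main : ∀ ε : ℤ, (ε = 1 ∨ ε = -1) → c + n * a = ε * (c + n' * a) →
      d + n * b = ε * (d + n' * b) → n = n' := by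
    rintro ε (rfl | rfl) e1 e2
    · linear_combination d * e1 - c * e2 - (n - n') * h
    · have : 2 * (a * d - c * b) = 0 := by linear_combination a * e2 - b * e1
      omega
  rcases num_den_reg (cop n) with ⟨h1, h2⟩ | ⟨h1, h2⟩ <;>
  rcases num_den_reg (cop n') with ⟨h3, h4⟩ | ⟨h3, h4⟩ <;>
  rw [he'] at h1 h2
  · exact main 1 (Or.inl rfl) (by linarith) (by linarith)
  · exact main (-1) (Or.inr rfl) (by linarith) (by linarith)
  · exact main (-1) (Or.inr rfl) (by linarith) (by linarith)
  · exact main 1 (Or.inl rfl) (by linarith) (by linarith)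

/-- The vectors (c, d) + n(a, b) run through the neighbours in boundary order, so the edge relation
becomes a recurrence in n. -/
theorem edgeEnds_neighbours {a b c d : ℤ} (h : a * d - c * b = 1) (n : ℤ) :
    EdgeEnds (reg a b) (reg (c + (n + 1) * a) (d + (n + 1) * b)) (reg (c + n * a) (d + n * b))
      (reg (c + (n + 2) * a) (d + (n + 2) * b)) := by
  have := edgeEnds_reg (a := a) (b := b) (c := c + (n + 1) * a) (d := d + (n + 1) * b)
    (by linear_combination h)
  rwa [show a - (c + (n + 1) * a) = -(c + n * a) by ring,
    show b - (d + (n + 1) * b) = -(d + n * b) by ring, reg_neg,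
    show a + (c + (n + 1) * a) = c + (n + 2) * a by ring,
    show b + (d + (n + 1) * b) = d + (n + 2) * b by ring] at this

/-- The values of the neighbours of a region grow exponentially in both directions. -/
theorem exists_pow_le_norm_neighbour {C : Region → Fin 3} (hC : IsColoring C) {p : Fin 3 → ℂ}
    {s : ℂ} {φ : Region → ℂ} {m : ℝ} (hφ : IsMarkoffMap C p s φ) (hBQ : SatisfiesBQ p s m φ)
    {a b c d : ℤ} (hdet : a * d - c * b = 1) :
    ∃ r k K : ℝ, 1 < r ∧ 0 < k ∧
      ∀ n : ℤ, k * r ^ n.natAbs - K ≤ ‖φ (reg (c + n * a) (d + n * b))‖ := by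
  have hE := edgeEnds_neighbours hdet
  have hinj := reg_add_mul_injective hdet
  have hx := hBQ.bq1 (reg a b)
  set x := φ (reg a b) with hxdef
  set Y : ℤ → Region := fun n => reg (c + n * a) (d + n * b) with hY
  have hE' : ∀ n, EdgeEnds (reg a b) (Y (n + 1)) (Y n) (Y (n + 2)) := hE
  have hx2 : x ≠ 2 := by simpa using hx 2 (by norm_num)
  have hx2' : x ≠ -2 := by simpa using hx (-2) (by norm_num)
  have hx4 : 4 - x ^ 2 ≠ 0 := by
    rw [show 4 - x ^ 2 = (2 - x) * (2 + x) by ring]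
    refine mul_ne_zero (sub_ne_zero.2 hx2.symm) fun h => hx2' ?_
    linear_combination h
  have hcol : ∀ n, C (Y (n + 2)) = C (Y n) := fun n => (hC.eq_of_edgeEnds (hE' n)).symm
  have hadj : ∀ n, C (Y n) ≠ C (Y (n + 1)) := fun n => (hC _ _ (hE' n).1.2.1).symm
  have hadjU : ∀ n, C (reg a b) ≠ C (Y n) := fun n => hC _ _ (hE' n).1.2.2
  -- Neighbour colours alternate, so this is a 2-periodic particular solution, given by the centre
  -- of the conic; subtracting it makes the recurrence homogeneous.
  set z : ℤ → ℂ := fun n => (2 * p (C (Y n)) - x * p (C (Y (n + 1)))) / (4 - x ^ 2) with hz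
  have hz1 : ∀ n, z (n + 1) = (2 * p (C (Y (n + 1))) - x * p (C (Y n))) / (4 - x ^ 2) := by
    intro n
    simp only [hz]
    rw [add_assoc, show (1 : ℤ) + 1 = 2 by norm_num, hcol]
  have hz2 : ∀ n, z (n + 2) = z n := by
    intro n
    simp only [hz]
    rw [hcol, show n + 2 + 1 = n + 1 + 2 by ring, hcol]
  have hrec : ∀ n, (φ (Y (n + 2)) - z (n + 2)) + (φ (Y n) - z n) =
      -x * (φ (Y (n + 1)) - z (n + 1)) := by
    intro n
    have h1 := hφ.edge _ _ _ _ (hE' n)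
    have h2 : 2 * z n + x * z (n + 1) = p (C (Y n)) := by
      rw [hz1]
      simp only [hz]
      field_simp
      ring
    rw [hz2]
    linear_combination h1 - h2
  rcases growth_or_decay_of_recurrence hx (d := fun n => φ (Y n) - z n) hrec with
    ⟨r, k, K, hr, hk, h⟩ | ⟨hq, σ, hσ, n₀, h⟩
  · refine ⟨r, k, K + (‖z 0‖ + ‖z 1‖), hr, hk, fun n => ?_⟩
    have hzn : ‖z n‖ ≤ ‖z 0‖ + ‖z 1‖ := by
      have hodd : ∀ n, (z n = z 0 ∧ z (n + 1) = z 1) ∨ (z n = z 1 ∧ z (n + 1) = z 0) := by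
        intro n
        induction n using Int.induction_on with
        | zero => left; simp
        | succ k ih =>
          rw [add_assoc, show (1 : ℤ) + 1 = 2 by norm_num, hz2]
          tauto
        | pred k ih =>
          have := hz2 (-k - 1)
          rw [show -(k : ℤ) - 1 + 2 = -k + 1 by ring] at this
          rw [sub_add_cancel, ← this]
          tauto
      rcases hodd n with ⟨e, -⟩ | ⟨e, -⟩ <;> rw [e]
      · linarith [norm_nonneg (z 1)]
      · linarith [norm_nonneg (z 0)]
    have h1 := h n
    have h2 := norm_sub_le (φ (Y n)) (z n)
    change _ ≤ ‖φ (Y n)‖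
    linarith
  · exfalso
    have hconic : conicPoly (p (C (reg a b))) (p (C (Y 0))) (p (C (Y 1))) s x = 0 := by
      have hv : IsVertex (reg a b) (Y 0) (Y 1) :=
        ⟨(hE' 0).1.2.2, (hE' 0).1.2.1.symm, (hE' 0).1.1⟩
      rw [← centered_conic hx4 (hφ.vertex_relation hC hv)]
      have e0 : z 0 = (2 * p (C (Y 0)) - x * p (C (Y 1))) / (4 - x ^ 2) := rfl
      have e1 : z 1 = (2 * p (C (Y 1)) - x * p (C (Y 0))) / (4 - x ^ 2) := hz1 0
      rw [← e0, ← e1, hq, mul_zero]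
    have hexc := mem_exceptionalSet_of_conicPoly (hadjU 0) (hadjU 1) (hadj 0) hconic
    have hsmall : ∀ n : ℕ, Y (σ * (n + n₀ : ℕ)) ∈ {X : Region | ‖φ X‖ ≤ bigL p s m} := by
      intro n
      have h1 := h (n + n₀) (Nat.le_add_left _ _)
      have h2 := norm_center_le hexc hx2 hx2' (hadj (σ * (n + n₀ : ℕ)))
      have h3 := norm_add_le (φ (Y (σ * (n + n₀ : ℕ))) - z (σ * (n + n₀ : ℕ)))
        (z (σ * (n + n₀ : ℕ)))
      rw [sub_add_cancel] at h3
      have h4 : centerBound p s + 1 ≤ bigL p s m := (le_max_right _ _).trans (le_max_right _ _)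
      change ‖φ (Y (σ * (n + n₀ : ℕ)))‖ ≤ _
      linarith
    refine (Set.infinite_of_injective_forall_mem ?_ hsmall) hBQ.bq2
    intro n n' he
    have := mul_left_cancel₀ hσ (hinj he)
    exact Nat.add_right_cancel (Int.natCast_inj.1 this)

/-- All but finitely many neighbours of a region have exponentially large values. -/
theorem exists_exp_le_norm_neighbour {C : Region → Fin 3} (hC : IsColoring C) {p : Fin 3 → ℂ}
    {s : ℂ} {φ : Region → ℂ} {m : ℝ} (hφ : IsMarkoffMap C p s φ) (hBQ : SatisfiesBQ p s m φ)
    (U : Region) : ∃ κ : ℝ, 0 < κ ∧ ∃ B : ℤ, ∀ W, IsEdge U W → B < height W →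
      4 * Real.exp (κ * height W) ≤ ‖φ W‖ := by
  obtain ⟨d, c, hdc⟩ := isCoprime_num_den U
  have hU := reg_num_den U
  generalize ha : num U = a at *
  generalize hb : den U = b at *
  have hdet : a * d - (-c) * b = 1 := by linear_combination hdc
  obtain ⟨r, k, K, hr, hk, h⟩ := exists_pow_le_norm_neighbour hC hφ hBQ hdet
  have hρ : 0 < Real.log r := Real.log_pos hr
  set A : ℝ := |a| + |b| + 1 with hA
  set A₀ : ℝ := |c| + |d| with hA₀
  have hApos : 0 < A := by positivity
  -- Half the available rate: the spare factor exp(κ · height) absorbs `k`, `K` and the factor 4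
  -- once the height exceeds `B`.
  set κ : ℝ := Real.log r / (2 * A) with hκ
  have hκ0 : 0 < κ := by positivity
  set k' : ℝ := k * Real.exp (-(2 * κ * A₀)) with hk'
  have hk'0 : 0 < k' := by positivity
  obtain ⟨B, hB⟩ := exists_int_gt ((4 + |K|) / k' / κ)
  refine ⟨κ, hκ0, B, fun W hW hBW => ?_⟩
  obtain ⟨n, rfl⟩ : ∃ n : ℤ, W = reg (-c + n * a) (d + n * b) := by
    have e := (isEdge_iff U W).1 hW
    have hWr := reg_num_den W
    rw [ha, hb] at e
    generalize num W = w₁ at *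
    generalize den W = w₂ at *
    rw [← hWr]
    rcases e with e | e
    · refine ⟨w₁ * d + c * w₂, congrArg₂ reg ?_ ?_⟩
      · linear_combination (-w₁) * hdc - c * e
      · linear_combination (-w₂) * hdc + d * e
    · refine ⟨-(w₁ * d + c * w₂), (reg_neg _ _).symm.trans (congrArg₂ reg ?_ ?_)⟩
      · linear_combination w₁ * hdc + c * e
      · linear_combination w₂ * hdc - d * e
  have hn := h n
  have hht : (height (reg (-c + n * a) (d + n * b)) : ℝ) ≤ A₀ + n.natAbs * A := by
    rw [height_reg ⟨-b, a, by linear_combination hdet⟩]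
    have h1 := abs_add_le (-c) (n * a)
    have h2 := abs_add_le d (n * b)
    rw [abs_mul, abs_neg] at h1
    rw [abs_mul] at h2
    have h3 : |-c + n * a| + |d + n * b| ≤ |c| + |d| + |n| * (|a| + |b| + 1) := by
      nlinarith [abs_nonneg n]
    rw [hA, hA₀, Nat.cast_natAbs]
    exact_mod_cast h3
  set N : ℝ := (height (reg (-c + n * a) (d + n * b)) : ℝ) with hN
  have hpow : Real.exp (2 * κ * N) * Real.exp (-(2 * κ * A₀)) ≤ r ^ n.natAbs := by
    rw [← Real.exp_add, ← Real.exp_log (pow_pos (zero_lt_one.trans hr) _), Real.log_pow]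
    apply Real.exp_le_exp.2
    have : 2 * κ * (A₀ + n.natAbs * A) = 2 * κ * A₀ + n.natAbs * Real.log r := by
      rw [hκ]; field_simp
    nlinarith
  have hBN : (4 + |K|) / k' < κ * N := by
    have h1 : (B : ℝ) < N := by rw [hN]; exact_mod_cast hBW
    have h2 := hB.trans h1
    rw [div_lt_iff₀ hκ0] at h2
    linarith
  set E := Real.exp (κ * N) with hE
  have hE2 : Real.exp (2 * κ * N) = E * E := by rw [hE, ← Real.exp_add]; congr 1; ring
  have hE1 : κ * N + 1 ≤ E := Real.add_one_le_exp _
  have hpos : 0 < (4 + |K|) / k' := by positivity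
  have hkE : 4 + |K| ≤ k' * E := by
    have : (4 + |K|) / k' ≤ E := by linarith
    rwa [div_le_iff₀ hk'0, mul_comm] at this
  have h1E : 1 ≤ E := by linarith
  have hfin : k' * (E * E) ≤ k * r ^ n.natAbs := by
    rw [hE2] at hpow
    have := mul_le_mul_of_nonneg_left hpow hk.le
    calc k' * (E * E) = k * (E * E * Real.exp (-(2 * κ * A₀))) := by rw [hk']; ring
      _ ≤ _ := this
  nlinarith [le_abs_self K, abs_nonneg K]

/-! ## Growth of the map -/

theorem two_add_alpha_le_bigL (p : Fin 3 → ℂ) (s : ℂ) (m : ℝ) : alpha p ≤ bigL p s m - 2 := by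
  have : 2 + alpha p ≤ bigL p s m := le_max_left _ _
  linarith

theorem le_bigL (p : Fin 3 → ℂ) (s : ℂ) (m : ℝ) : m ≤ bigL p s m :=
  (le_max_left _ _).trans (le_max_right _ _)

/-- Uniform growth around finitely many regions. -/
theorem exists_exp_le_norm_neighbour_of_finite {C : Region → Fin 3} (hC : IsColoring C)
    {p : Fin 3 → ℂ} {s : ℂ} {φ : Region → ℂ} {m : ℝ} (hφ : IsMarkoffMap C p s φ)
    (hBQ : SatisfiesBQ p s m φ) {S : Set Region} (hS : S.Finite) :
    ∃ κ : ℝ, 0 < κ ∧ ∃ B : ℤ, ∀ U ∈ S, ∀ W, IsEdge U W → B < height W →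
      4 * Real.exp (κ * height W) ≤ ‖φ W‖ := by
  induction S, hS using Set.Finite.induction_on with
  | empty => exact ⟨1, one_pos, 0, fun U hU => absurd hU (Set.notMem_empty U)⟩
  | @insert V S _ _ ih =>
    obtain ⟨κ, hκ, B, h⟩ := ih
    obtain ⟨κ', hκ', B', h'⟩ := exists_exp_le_norm_neighbour hC hφ hBQ V
    refine ⟨min κ κ', lt_min hκ hκ', max B B', fun U hU W hW hB => ?_⟩
    have hN : (0 : ℝ) ≤ height W := by exact_mod_cast (height_pos W).le
    rcases hU with rfl | hU
    · refine le_trans ?_ (h' W hW ((le_max_right _ _).trans_lt hB))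
      have := mul_le_mul_of_nonneg_right (min_le_right κ κ') hN
      have := Real.exp_le_exp.2 this
      linarith
    · refine le_trans ?_ (h U hU W hW ((le_max_left _ _).trans_lt hB))
      have := mul_le_mul_of_nonneg_right (min_le_left κ κ') hN
      have := Real.exp_le_exp.2 this
      linarith

/-- For each bound, only finitely many regions have a value below it. -/
theorem finite_norm_le {C : Region → Fin 3} (hC : IsColoring C) {p : Fin 3 → ℂ} {s : ℂ}
    {φ : Region → ℂ} {m : ℝ} (hm : IsSinkConstant C p s m) (hm2 : 2 < m)
    (hφ : IsMarkoffMap C p s φ) (hBQ : SatisfiesBQ p s m φ) (K : ℝ) :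
    {X : Region | ‖φ X‖ ≤ K}.Finite := by
  have hmL := le_bigL p s m
  have hα := two_add_alpha_le_bigL p s m
  have hfin := hBQ.bq2
  generalize bigL p s m = L at *
  have hL : 2 < L := hm2.trans_le hmL
  have hg := gain_pos hL
  obtain ⟨B, hB⟩ := exists_height_le_of_finite hfin
  obtain ⟨κ, hκ, B', hB'⟩ := exists_exp_le_norm_neighbour_of_finite hC hφ hBQ hfin
  -- Climb by levels of one gain. A high enough region at level k + 1 borders no region of value at
  -- most `L`, so both parents lie at level k, where heights are bounded by `B₁`; its height is at
  -- most `B₁ + B₁`.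
  have main : ∀ k : ℕ, {X : Region | ‖φ X‖ ≤ L + k * gain L}.Finite := by
    intro k
    induction k with
    | zero => simpa using hfin
    | succ k ih =>
      obtain ⟨B₁, hB₁⟩ := exists_height_le_of_finite ih
      obtain ⟨B₂, hB₂⟩ := exists_int_gt ((L + (k + 1 : ℕ) * gain L) / κ)
      refine (finite_height_le (max (max 1 B) (max (max B' B₂) (B₁ + B₁)))).subset ?_
      intro X hX
      by_contra hc
      have hc' : max (max 1 B) (max (max B' B₂) (B₁ + B₁)) < height X := not_le.1 hc
      simp only [max_lt_iff] at hc'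
      obtain ⟨⟨h1, h2⟩, ⟨h3, h4⟩, h5⟩ := hc'
      have hX' : ‖φ X‖ ≤ L + (k + 1 : ℕ) * gain L := hX
      obtain ⟨U, V, hU, hV, hsum, hdom⟩ := exists_parents_of_lt_height hm hφ hL hmL hα hB h1 h2
      have hnb : ∀ W ∈ {X : Region | ‖φ X‖ ≤ L}, ¬ IsEdge W X := by
        intro W hW he
        have e1 := hB' W hW X he h3
        have e2 := Real.add_one_le_exp (κ * height X)
        have e3 : (B₂ : ℝ) < height X := by exact_mod_cast h4
        have e4 := hB₂.trans e3
        rw [div_lt_iff₀ hκ] at e4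
        nlinarith [Real.exp_pos (κ * height X)]
      have hUL : L < ‖φ U‖ := not_le.1 fun h => hnb U h hU
      have hVL : L < ‖φ V‖ := not_le.1 fun h => hnb V h hV
      obtain ⟨d1, d2, -⟩ := hdom hUL hVL
      push_cast at hX'
      have b1 := hB₁ U (show ‖φ U‖ ≤ L + k * gain L by linarith)
      have b2 := hB₁ V (show ‖φ V‖ ≤ L + k * gain L by linarith)
      omega
  obtain ⟨k, hk⟩ := exists_nat_ge ((K - L) / gain L)
  rw [div_le_iff₀ hg] at hk
  exact (main k).subset fun X (hX : ‖φ X‖ ≤ K) =>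
    show ‖φ X‖ ≤ L + k * gain L by linarith

/-- The values of a Markoff map that satisfies the BQ-conditions grow exponentially with the
height. -/
theorem exists_exp_le_norm {C : Region → Fin 3} (hC : IsColoring C) {p : Fin 3 → ℂ} {s : ℂ}
    {φ : Region → ℂ} {m : ℝ} (hm : IsSinkConstant C p s m) (hm2 : 2 < m)
    (hφ : IsMarkoffMap C p s φ) (hBQ : SatisfiesBQ p s m φ) :
    ∃ κ K : ℝ, 0 < κ ∧ {X : Region | ‖φ X‖ ≤ K}.Finite ∧
      ∀ X, K < ‖φ X‖ → 4 * Real.exp (κ * height X) ≤ ‖φ X‖ := by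
  have hfinK := finite_norm_le hC hm hm2 hφ hBQ (max 16 (bigL p s m))
  have hmL := le_bigL p s m
  have hα := two_add_alpha_le_bigL p s m
  have hfin := hBQ.bq2
  generalize bigL p s m = L at *
  have hL : 2 < L := hm2.trans_le hmL
  obtain ⟨B, hB⟩ := exists_height_le_of_finite hfin
  obtain ⟨κ, hκ, B', hB'⟩ := exists_exp_le_norm_neighbour_of_finite hC hφ hBQ hfinK
  set D : ℤ := max (max 1 B) B' with hD
  have hD0 : (0 : ℝ) < D := by
    have : 1 ≤ D := (le_max_left _ _).trans (le_max_left _ _)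
    exact_mod_cast (by omega : 0 < D)
  have hlog : 0 < Real.log 4 := Real.log_pos (by norm_num)
  -- Up to height `D` the second rate gives 4 exp(κ' · height) ≤ 16, which starts the induction.
  refine ⟨min κ (Real.log 4 / D), max 16 L, lt_min hκ (by positivity), hfinK, ?_⟩
  set κ' := min κ (Real.log 4 / D) with hκ'
  have hind : ∀ n : ℕ, ∀ X, height X ≤ n → max 16 L < ‖φ X‖ →
      4 * Real.exp (κ' * height X) ≤ ‖φ X‖ := by
    intro n
    induction n with
    | zero =>
      intro X hX
      have := height_pos X
      push_cast at hX
      omega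
    | succ n ih =>
      intro X hX hKX
      have hN : (0 : ℝ) ≤ height X := by exact_mod_cast (height_pos X).le
      rcases le_or_gt (height X) D with hXD | hXD
      · have h1 : κ' * height X ≤ Real.log 4 := by
          have e1 := mul_le_mul_of_nonneg_right (min_le_right κ (Real.log 4 / D)) hN
          have e2 : (height X : ℝ) ≤ D := by exact_mod_cast hXD
          have e3 := mul_le_mul_of_nonneg_left e2 (div_pos hlog hD0).le
          rw [div_mul_cancel₀ _ hD0.ne'] at e3
          exact e1.trans e3
        have h2 := Real.exp_le_exp.2 h1
        rw [Real.exp_log (by norm_num)] at h2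
        have h3 := (le_max_left 16 L).trans_lt hKX
        linarith
      · simp only [hD, max_lt_iff] at hXD
        obtain ⟨⟨h1, h2⟩, h3⟩ := hXD
        obtain ⟨U, V, hU, hV, hsum, hdom⟩ := exists_parents_of_lt_height hm hφ hL hmL hα hB h1 h2
        have hUpos := height_pos U
        have hVpos := height_pos V
        have hnb : ∀ W, IsEdge W X → ‖φ W‖ ≤ max 16 L → 4 * Real.exp (κ' * height X) ≤ ‖φ X‖ := by
          intro W he hW
          refine le_trans ?_ (hB' W hW X he h3)
          have := Real.exp_le_exp.2 (mul_le_mul_of_nonneg_right (min_le_left κ (Real.log 4 / D)) hN)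
          linarith
        by_cases hUK : ‖φ U‖ ≤ max 16 L
        · exact hnb U hU hUK
        by_cases hVK : ‖φ V‖ ≤ max 16 L
        · exact hnb V hV hVK
        rw [not_le] at hUK hVK
        obtain ⟨-, -, hmul⟩ := hdom ((le_max_right _ _).trans_lt hUK)
          ((le_max_right _ _).trans_lt hVK)
        push_cast at hX
        have iU := ih U (by omega) hUK
        have iV := ih V (by omega) hVK
        have hE : Real.exp (κ' * height X) =
            Real.exp (κ' * height U) * Real.exp (κ' * height V) := by
          rw [← Real.exp_add, hsum]
          congr 1
          push_cast
          ring
        -- The two factors 4 from the parents, divided by the 4 in `hmul`, leave the single 4 of the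
        -- claim.
        have := mul_le_mul iU iV (by positivity) (norm_nonneg _)
        rw [hE]
        linarith
  intro X hX
  refine hind (height X).toNat X ?_ hX
  rw [Int.toNat_of_nonneg (height_pos X).le]

/-! ### Summability over the regions -/

theorem summable_exp_neg_mul_abs {c : ℝ} (hc : 0 < c) :
    Summable fun a : ℤ => Real.exp (-c * |(a : ℝ)|) := by
  have h : Summable fun n : ℕ => Real.exp (-c * n) := by
    have := summable_geometric_of_lt_one (Real.exp_pos (-c)).le 
      (Real.exp_lt_one_iff.2 (neg_lt_zero.2 hc))
    refine this.congr fun n => ?_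
    rw [← Real.exp_nat_mul, mul_comm]
  refine Summable.of_nat_of_neg ?_ ?_ <;> refine h.congr fun n => ?_ <;> simp

/-- Regions inject into ℤ² by numerator and denominator, where the exponential splits into a product
of two convergent series. -/
theorem summable_exp_neg_mul_height {c : ℝ} (hc : 0 < c) :
    Summable fun X : Region => Real.exp (-c * height X) := by
  have h := summable_exp_neg_mul_abs hc
  have h2 := h.mul_of_nonneg h (fun _ => (Real.exp_pos _).le) (fun _ => (Real.exp_pos _).le)
  have hinj : Function.Injective fun X : Region => (num X, den X) := by
    intro X Y he
    rw [Prod.mk.injEq] at he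
    rw [← reg_num_den X, ← reg_num_den Y, he.1, he.2]
  refine (h2.comp_injective hinj).congr fun X => ?_
  simp only [Function.comp_apply]
  rw [← Real.exp_add, height]
  congr 1
  push_cast
  ring

end MarkoffTree

open MarkoffTree
theorem corollary4 (C : Region → Fin 3) (hC : IsColoring C) (p : Fin 3 → ℂ) (s : ℂ)
    (m : ℝ) (hm : IsSinkConstant C p s m) (hm2 : 2 < m)
    (φ : Region → ℂ) (hφ : IsMarkoffMap C p s φ) (hBQ : SatisfiesBQ p s m φ)
    (t : ℝ) (ht : 0 < t) :
    Summable (fun X : Region => ‖φ X‖ ^ (-t)) := by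
  obtain ⟨κ, K, hκ, hfin, h⟩ := exists_exp_le_norm hC hm hm2 hφ hBQ
  refine Summable.of_norm_bounded_eventually
    (summable_exp_neg_mul_height (mul_pos hκ ht)) ?_
  -- The comparison may fail only on the finite set where ‖φ X‖ ≤ K.
  refine hfin.subset fun X hX => ?_
  by_contra hK
  refine hX ?_
  have h1 := h X (not_le.1 hK)
  have hexp := Real.exp_pos (κ * height X)
  have h2 : Real.exp (κ * height X) ≤ ‖φ X‖ := by linarith
  change ‖‖φ X‖ ^ (-t)‖ ≤ Real.exp (-(κ * t) * height X)
  rw [Real.norm_of_nonneg (Real.rpow_nonneg (norm_nonneg _) _)]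
  refine (Real.rpow_le_rpow_of_nonpos hexp h2 (neg_nonpos.2 ht.le)).trans (le_of_eq ?_)
  rw [← Real.exp_mul]
  congr 1
  ring
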